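/- Let $(\Omega,\mathcal F,\mathbb P)$ be a complete probability space, and let $(\gamma_t)_{t\ge 0}$ be a standard gamma process on it, i.e. a subordinator (a Lévy process started from $0$ with almost surely nondecreasing càdlàg paths) without drift satisfying $$\mathbb E\big[e^{-\lambda\gamma_t}\big]=\exp\Big(-t\int_0^\infty (1-e^{-\lambda x})\,\frac{e^{-x}}{x}\,dx\Big),\qquad t\ge 0,\ \lambda\ge 0.$$ Let $\tau:\Omega\to(0,\infty)$ be a random variable independent of the process $\gamma$. The gamma bridge of random length $\tau$ is the process $$\zeta_t:=\frac{\gamma_{t\wedge\tau}}{\gamma_\tau},\qquad t\ge 0.$$ Let $\mathcal F^{\zeta}_t:=\sigma(\zeta_s,\ s\le t)$ be its natural filtration and $\mathcal F^{\zeta,c}_t:=\mathcal F^\zeta_t\vee\mathcal N_{\mathbb P}$ its completed natural filtration, where $\mathcal N_{\mathbb P}$ is the collection of all $\mathbb P$-null sets. Then $\zeta$ is a (not necessarily time-homogeneous) Markov process with respect to $(\mathcal F^\zeta_t)_{t\ge0}$: each $\zeta_t$ is a random variable on $(\Omega,\mathcal F)$, and for all $t,h\ge 0$ and every bounded Borel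 measurable function $f:\mathbb R\to\mathbb R$, $$\mathbb E\big[f(\zeta_{t+h})\,\big|\,\mathcal F^\zeta_t\big]=\mathbb E\big[f(\zeta_{t+h})\,\big|\,\zeta_t\big]\qquad \mathbb P\text{-a.s.}$$ The same holds with respect to the completed natural filtration: for all such $t,h,f$, $$\mathbb E\big[f(\zeta_{t+h})\,\big|\,\mathcal F^{\zeta,c}_t\big]=\mathbb E\big[f(\zeta_{t+h})\,\big|\,\zeta_t\big]\qquad \mathbb P\text{-a.s.}$$ -/

import Mathlib

open MeasureTheory ProbabilityTheory Filter Topology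
open scoped NNReal

namespace GammaBridge

/-- A path `x : ℝ₊ → ℝ` is càdlàg: right continuous with left limits. -/
def IsCadlag (x : ℝ≥0 → ℝ) : Prop :=
  ∀ t, ContinuousWithinAt x (Set.Ici t) t ∧ ∃ l, Tendsto x (𝓝[<] t) (𝓝 l)

/-- A subordinator: a real Lévy process started from `0` whose paths are almost surely
nondecreasing (and càdlàg). -/
structure IsSubordinator {Ω : Type*} {m : MeasurableSpace Ω} (P : Measure Ω)
    (X : ℝ≥0 → Ω → ℝ) : Prop where
  measurable : ∀ t, Measurable (X t)
  zero : ∀ᵐ ω ∂P, X 0 ω = 0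
  cadlag : ∀ᵐ ω ∂P, IsCadlag (fun t => X t ω)
  monotone : ∀ᵐ ω ∂P, Monotone (fun t => X t ω)
  indepIncrements : HasIndepIncrements X P
  stationaryIncrements : ∀ s t : ℝ≥0,
    IdentDistrib (fun ω => X (s + t) ω - X s ω) (X t) P P

/-- A standard gamma process: a subordinator without drift whose Lévy measure is
`x⁻¹ e⁻ˣ dx` on `(0, ∞)`, as expressed by its Lévy-Khintchine (Laplace) representation. -/
structure IsStandardGammaProcess {Ω : Type*} {m : MeasurableSpace Ω} (P : Measure Ω)
    (γ : ℝ≥0 → Ω → ℝ) : Prop extends IsSubordinator P γ where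
  levyKhintchine : ∀ (t : ℝ≥0) (l : ℝ), 0 ≤ l →
    ∫ ω, Real.exp (-(l * γ t ω)) ∂P =
      Real.exp (-((t : ℝ) *
        ∫ x in Set.Ioi (0 : ℝ), (1 - Real.exp (-(l * x))) * (Real.exp (-x) / x)))

/-- The bridge of deterministic length `r` associated with `γ`:
`ζ^r_t = γ_{t ∧ r} / γ_r`. -/
noncomputable def bridge {Ω : Type*} (γ : ℝ≥0 → Ω → ℝ) (r : ℝ≥0) (t : ℝ≥0) (ω : Ω) : ℝ :=
  γ (min t r) ω / γ r ω

/-- The bridge of random length `τ` associated with `γ`: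
`ζ_t(ω) = ζ^r_t(ω)` at `r = τ(ω)`, that is `ζ_t = γ_{t ∧ τ} / γ_τ`. -/
noncomputable def randomBridge {Ω : Type*} (γ : ℝ≥0 → Ω → ℝ) (τ : Ω → ℝ≥0)
    (t : ℝ≥0) (ω : Ω) : ℝ :=
  bridge γ (τ ω) t ω

/-- The natural filtration `𝓕^Y_t = σ(Y_s, s ≤ t)`. -/
@[reducible] def naturalFiltration {Ω : Type*} (Y : ℝ≥0 → Ω → ℝ) (t : ℝ≥0) : MeasurableSpace Ω :=
  ⨆ s : ℝ≥0, ⨆ _ : s ≤ t, MeasurableSpace.comap (Y s) inferInstance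

/-- The completed natural filtration `𝓕^{Y,c}_t = 𝓕^Y_t ∨ 𝓝_P`, where `𝓝_P` is the collection
of all `P`-null sets. -/
@[reducible] def completedNaturalFiltration {Ω : Type*} {m : MeasurableSpace Ω} (P : Measure Ω)
    (Y : ℝ≥0 → Ω → ℝ) (t : ℝ≥0) : MeasurableSpace Ω :=
  naturalFiltration Y t ⊔ MeasurableSpace.generateFrom {N : Set Ω | P N = 0}

/-- `Y` is a (not necessarily time-homogeneous) Markov process with respect to `𝓕`:
`𝓕` is a filtration in the ambient σ-algebra, `Y` is adapted to it, and
`E[f(Y_{t+h}) | 𝓕_t] = E[f(Y_{t+h}) | Y_t]` almost surely for all `t, h ≥ 0` and all bounded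
measurable `f`. -/
structure IsMarkov {Ω : Type*} {m : MeasurableSpace Ω} (P : Measure Ω)
    (Y : ℝ≥0 → Ω → ℝ) (𝓕 : ℝ≥0 → MeasurableSpace Ω) : Prop where
  mono : Monotone 𝓕
  le : ∀ t, 𝓕 t ≤ m
  adapted : ∀ t, Measurable[𝓕 t] (Y t)
  condExp_eq : ∀ (t h : ℝ≥0) (f : ℝ → ℝ), Measurable f → (∃ C : ℝ, ∀ x, |f x| ≤ C) →
    P[fun ω => f (Y (t + h) ω) | 𝓕 t] =ᵐ[P]
      P[fun ω => f (Y (t + h) ω) | MeasurableSpace.comap (Y t) inferInstance]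

end GammaBridge

/-! Fix `t` and let `D` be generated by the ratios `γ_s / γ_t`, `s ≤ t`. The proof rests on the
independence of `D` from `G = σ(γ_u, u ≥ t) ∨ σ(τ)`, together with an identity for the past of the
bridge. Since gamma paths are a.s. strictly increasing, `{t < τ}` is a.s. the event `{ζ_t ≠ 1}`, and
on it `ζ_s = (γ_s / γ_t) ζ_t` for `s ≤ t`. There the past thus adds only `D` to `σ(ζ_t)`. Up to null
sets `ζ_t` and `ζ_{t+h}` are `G`-measurable, so `D` can be dropped from the conditioning
(`condExp_sup_eq_of_indep`). On `{ζ_t = 1}` the bridge has been absorbed at `1` and `ζ_{t+h} = 1`.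
`condExp_eq_of_trace` glues the two cases.

The independence of `D` from `γ_t` is special to the gamma process. Its Laplace exponent satisfies
`Ψ(θ + l) = Ψ(θ) + Ψ(l / (1 + θ))`, so weighting by `exp(-θ γ_t)` acts on the law of the path up to
`t` as division by `1 + θ`, up to a constant factor. Events expressed by ratios do not see the
scaling, hence `E[exp(-θ γ_t); A] = P(A) E[exp(-θ γ_t)]` for such `A`, and uniqueness of Laplace
transforms concludes. Independent increments and the independence of `τ` extend this from `γ_t` to
`G`. The same relation gives `Ψ(2^n - 1) = n Ψ(1)`, hence `γ_t > 0` a.s. for `t > 0` and strict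
monotonicity. -/

namespace GammaBridge

/-! ### Independence and conditioning for joins and completions of σ-algebras -/

section SigmaAlgebras

variable {Ω : Type*} {m : MeasurableSpace Ω} {P : Measure Ω}

/-- The intersections of a set of `A` with a set of `B`. -/
def interSets (A B : MeasurableSpace Ω) : Set (Set Ω) :=
  {s | ∃ a b, MeasurableSet[A] a ∧ MeasurableSet[B] b ∧ s = a ∩ b}

theorem isPiSystem_interSets (A B : MeasurableSpace Ω) : IsPiSystem (interSets A B) := by
  rintro _ ⟨a, b, ha, hb, rfl⟩ _ ⟨a', b', ha', hb', rfl⟩ -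
  exact ⟨a ∩ a', b ∩ b', @MeasurableSet.inter _ A _ _ ha ha', @MeasurableSet.inter _ B _ _ hb hb',
    Set.inter_inter_inter_comm _ _ _ _⟩

theorem sup_eq_generateFrom_interSets (A B : MeasurableSpace Ω) :
    A ⊔ B = MeasurableSpace.generateFrom (interSets A B) := by
  apply le_antisymm
  · refine sup_le (fun s hs => ?_) (fun s hs => ?_)
    · exact MeasurableSpace.measurableSet_generateFrom
        ⟨s, Set.univ, hs, @MeasurableSet.univ _ B, by simp⟩
    · exact MeasurableSpace.measurableSet_generateFrom
        ⟨Set.univ, s, @MeasurableSet.univ _ A, hs, by simp⟩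
  · refine MeasurableSpace.generateFrom_le ?_
    rintro _ ⟨a, b, ha, hb, rfl⟩
    exact @MeasurableSet.inter _ (A ⊔ B) _ _ (le_sup_left (b := B) _ ha)
      (le_sup_right (a := A) _ hb)

/-- If `A` is independent of `B`, and `A ⊔ B` of `C`, then `A` is independent of `B ⊔ C`. -/
theorem indep_sup_of_indep_sup [IsZeroOrProbabilityMeasure P] {A B C : MeasurableSpace Ω}
    (hA : A ≤ m) (hB : B ≤ m) (hC : C ≤ m) (hAB : Indep A B P) (hABC : Indep (A ⊔ B) C P) :
    Indep A (B ⊔ C) P := by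
  refine IndepSets.indep hA (sup_le hB hC) (@MeasurableSpace.isPiSystem_measurableSet Ω A)
    (isPiSystem_interSets B C) (@MeasurableSpace.generateFrom_measurableSet Ω A).symm
    (sup_eq_generateFrom_interSets B C) ?_
  rw [IndepSets_iff]
  rintro a _ ha ⟨b, c, hb, hc, rfl⟩
  rw [Indep_iff] at hAB hABC
  have h1 : MeasurableSet[A ⊔ B] b := le_sup_right (a := A) _ hb
  have h2 : MeasurableSet[A ⊔ B] (a ∩ b) :=
    @MeasurableSet.inter _ (A ⊔ B) _ _ (le_sup_left (b := B) _ ha) h1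
  rw [← Set.inter_assoc, hABC _ _ h2 hc, hABC _ _ h1 hc, hAB _ _ ha hb, mul_assoc]

theorem indep_eventuallyMeasurableSpace {A B : MeasurableSpace Ω} (h : Indep A B P) :
    Indep A (eventuallyMeasurableSpace B (ae P)) P := by
  rw [Indep_iff] at h ⊢
  rintro a b ha ⟨b', hb', hbb'⟩
  rw [measure_congr (EventuallyEq.rfl.inter hbb'), measure_congr hbb', h _ _ ha hb']

theorem eventuallyMeasurableSpace_le_of_isComplete [P.IsComplete] {A : MeasurableSpace Ω}
    (hA : A ≤ m) : eventuallyMeasurableSpace A (ae P) ≤ m := by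
  rintro s ⟨t, ht, hst⟩
  exact NullMeasurableSet.measurable_of_complete ⟨t, hA _ ht, hst⟩

theorem measurable_eventually_congr {E : Type*} [MeasurableSpace E] {A : MeasurableSpace Ω}
    {f g : Ω → E} (hf : Measurable[eventuallyMeasurableSpace A (ae P)] f) (hfg : f =ᵐ[P] g) :
    Measurable[eventuallyMeasurableSpace A (ae P)] g :=
  EventuallyMeasurable.congr hf hfg.symm

/-- Conditioning on extra information that is independent of everything of interest
changes nothing. -/
theorem condExp_sup_eq_of_indep [IsProbabilityMeasure P] {D Z G : MeasurableSpace Ω}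
    (hD : D ≤ m) (hG : G ≤ m) (hZG : Z ≤ G) (hDG : Indep D G P) {X : Ω → ℝ}
    (hX : StronglyMeasurable[G] X) (hXi : Integrable X P) :
    P[X | D ⊔ Z] =ᵐ[P] P[X | Z] := by
  have hZ : Z ≤ m := hZG.trans hG
  have hDZ : D ⊔ Z ≤ m := sup_le hD hZ
  -- Independence factors the integral over `d ∩ z`. Used for both `X` and `P[X | Z]`, whose
  -- integrals over `z` agree, this settles a π-system generating `D ⊔ Z`.
  have key : ∀ (Y : Ω → ℝ), StronglyMeasurable[G] Y → Integrable Y P →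
      ∀ d z, MeasurableSet[D] d → MeasurableSet[Z] z →
        ∫ ω in d ∩ z, Y ω ∂P = P.real d * ∫ ω in z, Y ω ∂P := by
    intro Y hY hYi d z hd hz
    have hzG := hZG _ hz
    have hYz : StronglyMeasurable[G] (z.indicator Y) := hY.indicator hzG
    have hYzi : Integrable (z.indicator Y) P := hYi.indicator (hG _ hzG)
    have h1 := condExp_indep_eq hG hD hYz hDG.symm
    have : ∫ ω in d, z.indicator Y ω ∂P = ∫ ω in d, (∫ ω, z.indicator Y ω ∂P) ∂P := by
      rw [← setIntegral_condExp hD hYzi hd]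
      exact setIntegral_congr_ae (hD _ hd) (h1.mono fun ω hω _ => hω)
    rw [setIntegral_indicator (hG _ hzG), integral_indicator (hG _ hzG), setIntegral_const] at this
    simpa using this
  refine (ae_eq_condExp_of_forall_setIntegral_eq hDZ hXi
    (fun s _ _ => integrable_condExp.integrableOn) (fun s hs hfin => ?_)
    (StronglyMeasurable.mono (stronglyMeasurable_condExp (m := Z))
      (le_sup_right : Z ≤ D ⊔ Z)).aestronglyMeasurable).symm
  clear hfin
  induction s, hs using MeasurableSpace.induction_on_inter
    (sup_eq_generateFrom_interSets D Z) (isPiSystem_interSets D Z) with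
  | empty => simp
  | basic t ht =>
    obtain ⟨d, z, hd, hz, rfl⟩ := ht
    rw [key _ (stronglyMeasurable_condExp.mono hZG) integrable_condExp d z hd hz,
      key X hX hXi d z hd hz, setIntegral_condExp hZ hXi hz]
  | compl t ht ih =>
    have htm := hDZ _ ht
    rw [setIntegral_compl htm integrable_condExp, setIntegral_compl htm hXi, ih,
      integral_condExp hZ]
  | iUnion f hd hf ih =>
    rw [integral_iUnion (fun i => hDZ _ (hf i)) hd integrable_condExp.integrableOn,
      integral_iUnion (fun i => hDZ _ (hf i)) hd hXi.integrableOn]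
    exact tsum_congr ih

end SigmaAlgebras

/-! ### Uniqueness of multivariate Laplace transforms -/

section Laplace

variable {ι : Type*} [Fintype ι]

/-- The bounded continuous function `x ↦ exp (-∑ i, l i * x i)` on the nonnegative orthant. -/
noncomputable def expNeg (l : ι → ℝ≥0) : BoundedContinuousFunction (ι → ℝ≥0) ℝ :=
  BoundedContinuousFunction.ofNormedAddCommGroup
    (fun x => Real.exp (-∑ i, (l i : ℝ) * x i)) (by fun_prop) 1 (fun x => by
      rw [Real.norm_eq_abs, Real.abs_exp, Real.exp_le_one_iff, neg_nonpos]
      positivity)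

theorem expNeg_apply (l x : ι → ℝ≥0) : expNeg l x = Real.exp (-∑ i, (l i : ℝ) * x i) := rfl

/-- `expNeg` as a homomorphism from the additive monoid of its parameters. -/
noncomputable def expNegHom :
    Multiplicative (ι → ℝ≥0) →* BoundedContinuousFunction (ι → ℝ≥0) ℝ where
  toFun l := expNeg l.toAdd
  map_one' := by ext x; simp [expNeg_apply]
  map_mul' l k := by
    ext x
    simp only [BoundedContinuousFunction.coe_mul, Pi.mul_apply, expNeg_apply, ← Real.exp_add,
      toAdd_mul, Pi.add_apply, NNReal.coe_add, add_mul, Finset.sum_add_distrib, neg_add]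

/-- The algebra generated by the functions `expNeg`. -/
noncomputable def expNegAlgebra :
    StarSubalgebra ℝ (BoundedContinuousFunction (ι → ℝ≥0) ℝ) where
  toSubalgebra := Algebra.adjoin ℝ (MonoidHom.mrange (expNegHom (ι := ι)) : Set _)
  star_mem' {a} ha := by
    have : star a = a := by ext x; simp
    rwa [this]

/-- Products of exponentials are exponentials, so the algebra they generate is their linear span. It
separates points, and by linearity the integrals agree on all of it. -/
theorem measure_ext_of_laplace_nnreal {μ ν : Measure (ι → ℝ≥0)} [IsFiniteMeasure μ]
    [IsFiniteMeasure ν] (h : ∀ l, ∫ x, expNeg l x ∂μ = ∫ x, expNeg l x ∂ν) : μ = ν := by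
  classical
  refine ext_of_forall_mem_subalgebra_integral_eq_of_pseudoEMetric_complete_countable
    (𝕜 := ℝ) (A := expNegAlgebra) ?_ ?_
  · intro x y hxy
    obtain ⟨i, hi⟩ := Function.ne_iff.1 hxy
    refine ⟨_, ⟨_, ⟨expNeg (Pi.single i 1), ?_, rfl⟩, rfl⟩, ?_⟩
    · exact Algebra.subset_adjoin ⟨Multiplicative.ofAdd (Pi.single i 1), rfl⟩
    · simpa [expNeg_apply, Pi.single_apply, apply_ite] using hi
  · intro g hg
    change g ∈ Subalgebra.toSubmodule (Algebra.adjoin ℝ _) at hg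
    rw [Algebra.adjoin_eq_span, Submonoid.closure_eq] at hg
    induction hg using Submodule.span_induction with
    | mem g hg =>
      obtain ⟨l, rfl⟩ := hg
      exact h _
    | zero => simp
    | add f g _ _ hf hg =>
      simp only [BoundedContinuousFunction.coe_add, Pi.add_apply]
      rw [integral_add (f.integrable _) (g.integrable _),
        integral_add (f.integrable _) (g.integrable _), hf, hg]
    | smul c f _ hf =>
      simp only [BoundedContinuousFunction.coe_smul]
      rw [integral_smul, integral_smul, hf]

/-- Finite measures on the nonnegative orthant are determined by their Laplace transform. -/
theorem measure_ext_of_laplace {μ ν : Measure (ι → ℝ)} [IsFiniteMeasure μ] [IsFiniteMeasure ν]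
    (hμ : ∀ᵐ x ∂μ, ∀ i, 0 ≤ x i) (hν : ∀ᵐ x ∂ν, ∀ i, 0 ≤ x i)
    (h : ∀ l : ι → ℝ, (∀ i, 0 ≤ l i) →
      ∫ x, Real.exp (-∑ i, l i * x i) ∂μ = ∫ x, Real.exp (-∑ i, l i * x i) ∂ν) : μ = ν := by
  let φ : (ι → ℝ) → (ι → ℝ≥0) := fun x i => (x i).toNNReal
  let c : (ι → ℝ≥0) → (ι → ℝ) := fun x i => x i
  have hφ : Measurable φ := by fun_prop
  have hc : Measurable c := by fun_prop
  have hback : ∀ ρ : Measure (ι → ℝ), (∀ᵐ x ∂ρ, ∀ i, 0 ≤ x i) → (ρ.map φ).map c = ρ := by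
    intro ρ hρ
    rw [Measure.map_map hc hφ]
    conv_rhs => rw [← Measure.map_id (μ := ρ)]
    refine Measure.map_congr (hρ.mono fun x hx => ?_)
    ext i
    simp [c, φ, hx i]
  have hint : ∀ ρ : Measure (ι → ℝ), (∀ᵐ x ∂ρ, ∀ i, 0 ≤ x i) → ∀ l : ι → ℝ≥0,
      ∫ x, expNeg l x ∂(ρ.map φ) = ∫ x, Real.exp (-∑ i, (l i : ℝ) * x i) ∂ρ := by
    intro ρ hρ l
    rw [integral_map hφ.aemeasurable (expNeg l).continuous.aestronglyMeasurable]
    refine integral_congr_ae (hρ.mono fun x hx => ?_)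
    simp [expNeg_apply, φ, hx]
  rw [← hback μ hμ, ← hback ν hν]
  congr 1
  refine measure_ext_of_laplace_nnreal fun l => ?_
  rw [hint μ hμ, hint ν hν]
  exact h _ fun i => (l i).2

end Laplace

/-! ### Independence of past and future increments -/

section IndepIncrements

/-- Sorts finitely many times into a sequence starting at `0` and stationary at `b`, the form in
which independence of increments can be applied. -/
theorem exists_monotone_seq_range (I : Finset ℝ≥0) : ∀ b : ℝ≥0, (∀ s ∈ I, s ≤ b) →
    ∃ (t : ℕ → ℝ≥0) (n : ℕ), Monotone t ∧ t 0 = 0 ∧ (∀ k, n ≤ k → t k = b) ∧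
      ∀ s ∈ I, ∃ k ≤ n, t k = s := by
  induction I using Finset.induction_on_max with
  | empty =>
    intro b _
    refine ⟨fun k => if k = 0 then 0 else b, 1, ?_, by simp, fun k hk => ?_, by simp⟩
    · intro i j hij
      by_cases hi : i = 0
      · simp [hi]
      · have : j ≠ 0 := by lia
        simp [hi, this]
    · have : k ≠ 0 := by lia
      simp [this]
  | insert a I hI ih =>
    intro b hb
    obtain ⟨t, n, htm, ht0, htn, hts⟩ := ih a fun s hs => (hI s hs).le
    have hab : a ≤ b := hb a (Finset.mem_insert_self _ _)
    refine ⟨fun k => if k ≤ n then t k else b, n + 1, ?_, by simp [ht0], fun k hk => ?_, ?_⟩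
    · intro i j hij
      by_cases hj : j ≤ n
      · have hi : i ≤ n := hij.trans hj
        simpa [hi, hj] using htm hij
      · by_cases hi : i ≤ n
        · simpa [hi, hj] using ((htm hi).trans (htn n le_rfl).le).trans hab
        · simp [hi, hj]
    · have : ¬ k ≤ n := by lia
      simp [this]
    · intro s hs
      obtain rfl | hs := Finset.mem_insert.1 hs
      · exact ⟨n, by lia, by simp [htn n le_rfl]⟩
      · obtain ⟨k, hk, rfl⟩ := hts s hs
        exact ⟨k, by lia, by simp [hk]⟩

variable {Ω : Type*} {m : MeasurableSpace Ω} {P : Measure Ω} {X : ℝ≥0 → Ω → ℝ}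

/-- The σ-algebra generated by the values of `X` at the times in `S`. -/
@[reducible] def sigmaOn (X : ℝ≥0 → Ω → ℝ) (S : Set ℝ≥0) : MeasurableSpace Ω :=
  MeasurableSpace.comap (fun ω (s : S) => X s ω) MeasurableSpace.pi

theorem measurable_sigmaOn {S : Set ℝ≥0} {s : ℝ≥0} (hs : s ∈ S) :
    Measurable[sigmaOn X S] (X s) :=
  (@measurable_pi_iff _ _ _ (sigmaOn X S) _ _).1 (comap_measurable _) ⟨s, hs⟩

theorem sigmaOn_le {S : Set ℝ≥0} {A : MeasurableSpace Ω} (h : ∀ s ∈ S, Measurable[A] (X s)) :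
    sigmaOn X S ≤ A :=
  Measurable.comap_le (measurable_pi_lambda _ fun s => h s s.2)

theorem sigmaOn_mono {S T : Set ℝ≥0} (h : S ⊆ T) : sigmaOn X S ≤ sigmaOn X T :=
  sigmaOn_le fun _ hs => measurable_sigmaOn (h hs)

/-- An increment of a process with independent increments is independent of the past. -/
theorem indep_past_increment [IsProbabilityMeasure P] (hX : ∀ t, Measurable (X t))
    (hX0 : ∀ᵐ ω ∂P, X 0 ω = 0) (hinc : HasIndepIncrements X P) {b c : ℝ≥0} (hbc : b ≤ c) :
    Indep (sigmaOn X (Set.Iic b)) (MeasurableSpace.comap (X c - X b) inferInstance) P := by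
  classical
  refine IndepFun.process_indepFun (X := fun (s : Set.Iic b) => X s) (fun s => hX s)
    ((hX c).sub (hX b)) fun I => ?_
  obtain ⟨t, n, htm, ht0, htn, hts⟩ := exists_monotone_seq_range
    (I.image Subtype.val) b (by simp +contextual)
  -- Since `r n = b` and `r (n + 1) = c`, the increment of index `n` is `X c - X b`, and those of
  -- smaller index lie before `b`.
  let r : ℕ → ℝ≥0 := fun k => if k ≤ n then t k else c
  have hr : Monotone r := by
    intro i j hij
    by_cases hj : j ≤ n
    · have hi : i ≤ n := hij.trans hj
      simpa [r, hi, hj] using htm hij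
    · by_cases hi : i ≤ n
      · simpa [r, hi, hj] using ((htm hi).trans (htn n le_rfl).le).trans hbc
      · simp [r, hi, hj]
  have hind := (hinc.nat hr).indepFun_finset (Finset.range n) {n}
    (by simp) (fun i => (hX _).sub (hX _))
  have hk : ∀ s : I, ∃ k ≤ n, t k = s := fun s =>
    hts s (Finset.mem_image_of_mem _ s.2)
  choose k hkn hks using hk
  have hkmem : ∀ (s : I) (i : ℕ), i ∈ Finset.range (k s) → i ∈ Finset.range n := fun s i hi =>
    Finset.mem_range.2 ((Finset.mem_range.1 hi).trans_le (hkn s))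
  -- Partial sums of increments recover the past values of `X`, because `X 0 = 0` a.s.
  let F : (Finset.range n → ℝ) → (I → ℝ) := fun x s =>
    ∑ i : Finset.range n, if (i : ℕ) < k s then x i else 0
  let G : (({n} : Finset ℕ) → ℝ) → ℝ := fun x => x ⟨n, Finset.mem_singleton_self n⟩
  have hF : Measurable F := by
    refine measurable_pi_lambda _ fun s => Finset.measurable_sum _ fun i _ => ?_
    by_cases hi : (i : ℕ) < k s
    · simpa [hi] using measurable_pi_apply i
    · simp [hi]
  refine (hind.comp hF (measurable_pi_apply _ : Measurable G)).congr ?_ ?_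
  · filter_upwards [hX0] with ω hω
    ext s
    have hsum : ∀ j ≤ n, ∑ i ∈ Finset.range j, (X (r (i + 1)) ω - X (r i) ω) = X (t j) ω := by
      intro j hj
      rw [Finset.sum_range_sub (fun i => X (r i) ω)]
      simp [r, hj, ht0, hω]
    simp only [Function.comp, F]
    rw [Finset.sum_coe_sort (Finset.range n)
      (fun i => if i < k s then X (r (i + 1)) ω - X (r i) ω else 0), ← Finset.sum_filter]
    have : (Finset.range n).filter (· < k s) = Finset.range (k s) := by
      ext i
      simp only [Finset.mem_filter, Finset.mem_range]
      exact ⟨fun h => h.2, fun h => ⟨h.trans_le (hkn s), h⟩⟩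
    rw [this, hsum _ (hkn s), hks]
  · refine ae_of_all _ fun ω => ?_
    simp [r, htn n le_rfl]

/-- The increments after `t` of a process with independent increments are jointly independent
of the past of `t`. -/
theorem indep_past_increments [IsProbabilityMeasure P] (hX : ∀ t, Measurable (X t))
    (hX0 : ∀ᵐ ω ∂P, X 0 ω = 0) (hinc : HasIndepIncrements X P) (t : ℝ≥0) :
    Indep (sigmaOn X (Set.Iic t)) (sigmaOn (fun u => X u - X t) (Set.Ici t)) P := by
  classical
  have hpast : ∀ b, sigmaOn X (Set.Iic b) ≤ m := fun b => sigmaOn_le fun s _ => hX s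
  have key : ∀ J : Finset ℝ≥0, (∀ u ∈ J, t ≤ u) →
      Indep (sigmaOn X (Set.Iic t)) (sigmaOn (fun u => X u - X t) J) P := by
    intro J
    induction J using Finset.induction_on_max with
    | empty =>
      intro _
      refine indep_of_indep_of_le_right (indep_bot_right _) (sigmaOn_le ?_)
      simp
    | insert a J hJ ih =>
      intro h
      have hJt : ∀ u ∈ J, t ≤ u := fun u hu => h u (Finset.mem_insert_of_mem hu)
      -- `b` is the last time before `a` (or `t` if there is none), so that `X a - X t` is `X a - X
      -- b` plus an increment already treated.
      obtain ⟨b, htb, hba, hJb, hbJ⟩ : ∃ b, t ≤ b ∧ b ≤ a ∧ (∀ u ∈ J, u ≤ b) ∧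
          (b ∈ J ∨ b = t) := by
        obtain rfl | hne := J.eq_empty_or_nonempty
        · exact ⟨t, le_rfl, h a (by simp), by simp, Or.inr rfl⟩
        · exact ⟨J.max' hne, hJt _ (J.max'_mem hne), (hJ _ (J.max'_mem hne)).le,
            fun u hu => J.le_max' u hu, Or.inl (J.max'_mem hne)⟩
      have hA : sigmaOn X (Set.Iic t) ≤ sigmaOn X (Set.Iic b) :=
        sigmaOn_mono (Set.Iic_subset_Iic.2 htb)
      have hB : sigmaOn (fun u => X u - X t) J ≤ sigmaOn X (Set.Iic b) :=
        sigmaOn_le fun u hu => (measurable_sigmaOn (Set.mem_Iic.2 (hJb u hu))).sub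
          (measurable_sigmaOn (Set.mem_Iic.2 htb))
      have hC : MeasurableSpace.comap (X a - X b) inferInstance ≤ m :=
        ((hX a).sub (hX b)).comap_le
      have hmain := indep_sup_of_indep_sup (hpast t) (hB.trans (hpast b)) hC (ih hJt)
        (indep_of_indep_of_le_left (indep_past_increment hX hX0 hinc hba) (sup_le hA hB))
      refine indep_of_indep_of_le_right hmain (sigmaOn_le fun u hu => ?_)
      have hJm : ∀ u ∈ J, Measurable[sigmaOn (fun u => X u - X t) J ⊔
          MeasurableSpace.comap (X a - X b) inferInstance] (X u - X t) := fun u hu =>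
        (measurable_sigmaOn (X := fun u => X u - X t) (Finset.mem_coe.2 hu)).mono
          le_sup_left le_rfl
      obtain rfl | hu := Finset.mem_insert.1 (Finset.mem_coe.1 hu)
      · have h1 : Measurable[sigmaOn (fun u => X u - X t) J ⊔
            MeasurableSpace.comap (X u - X b) inferInstance] (X u - X b) :=
          (comap_measurable _).mono le_sup_right le_rfl
        obtain hb | rfl := hbJ
        · have := h1.add (hJm b hb)
          rwa [sub_add_sub_cancel] at this
        · exact h1
      · exact hJm u hu
  refine IndepFun.indepFun_process (Y := fun (u : Set.Ici t) => X u - X t)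
    (measurable_pi_lambda _ fun s => hX s) (fun u => (hX u).sub (hX t)) fun J => ?_
  have := key (J.image Subtype.val) (by
    intro u hu
    obtain ⟨v, -, rfl⟩ := Finset.mem_image.1 hu
    exact v.2)
  refine indep_of_indep_of_le_right this
    (Measurable.comap_le (@measurable_pi_lambda _ _ _ (_) _ _ fun u => ?_))
  exact measurable_sigmaOn (X := fun u => X u - X t)
    (Finset.mem_coe.2 (Finset.mem_image_of_mem _ u.2))

end IndepIncrements

/-! ### The Laplace exponent and its scaling relation -/

section LaplaceExponent

/-- The Laplace exponent of the standard gamma process. -/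
noncomputable def laplaceExponent (l : ℝ) : ℝ :=
  ∫ x in Set.Ioi (0 : ℝ), (1 - Real.exp (-(l * x))) * (Real.exp (-x) / x)

theorem integrableOn_laplaceExponent {l : ℝ} (hl : 0 ≤ l) :
    IntegrableOn (fun x => (1 - Real.exp (-(l * x))) * (Real.exp (-x) / x)) (Set.Ioi (0 : ℝ)) := by
  have hbound : IntegrableOn (fun x : ℝ => l * Real.exp (-x)) (Set.Ioi (0 : ℝ)) :=
    (integrableOn_exp_neg_Ioi 0).const_mul l
  refine Integrable.mono' hbound (Measurable.aestronglyMeasurable (by fun_prop)) ?_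
  filter_upwards [ae_restrict_mem measurableSet_Ioi] with x hx
  have hx : 0 < x := hx
  have h1 : Real.exp (-(l * x)) ≤ 1 := Real.exp_le_one_iff.2 (by nlinarith)
  have h2 : 1 - Real.exp (-(l * x)) ≤ l * x := by
    have := Real.add_one_le_exp (-(l * x))
    linarith
  rw [Real.norm_eq_abs, abs_of_nonneg (mul_nonneg (by linarith) (by positivity))]
  calc (1 - Real.exp (-(l * x))) * (Real.exp (-x) / x)
      ≤ (l * x) * (Real.exp (-x) / x) := by gcongr
    _ = l * Real.exp (-x) := by field_simp

/-- The scaling relation of the Laplace exponent, which expresses that exponential tilting of a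
gamma distribution is a scaling. -/
theorem laplaceExponent_add {l θ : ℝ} (hl : 0 ≤ l) (hθ : 0 ≤ θ) :
    laplaceExponent (θ + l) = laplaceExponent θ + laplaceExponent (l / (1 + θ)) := by
  have hθ' : 0 < 1 + θ := by linarith
  have h1 : laplaceExponent (l / (1 + θ)) = laplaceExponent (θ + l) - laplaceExponent θ := by
    unfold laplaceExponent
    rw [← integral_sub (integrableOn_laplaceExponent (by positivity))
      (integrableOn_laplaceExponent hθ)]
    -- The substitution `x ↦ (1 + θ) x` leaves `dx / x` invariant and turns `exp(-x)` into `exp(-θx)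
    -- exp(-x)`.
    have := integral_comp_mul_left_Ioi
      (fun x => (1 - Real.exp (-(l / (1 + θ) * x))) * (Real.exp (-x) / x)) 0 hθ'
    rw [mul_zero, smul_eq_mul, eq_inv_mul_iff_mul_eq₀ hθ'.ne'] at this
    rw [← this, ← integral_const_mul]
    refine setIntegral_congr_fun measurableSet_Ioi fun x hx => ?_
    have hx : x ≠ 0 := (Set.mem_Ioi.1 hx).ne'
    have e1 : l / (1 + θ) * ((1 + θ) * x) = l * x := by field_simp
    have e2 : Real.exp (-((1 + θ) * x)) = Real.exp (-(θ * x)) * Real.exp (-x) := by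
      rw [← Real.exp_add]; ring_nf
    have e3 : Real.exp (-((θ + l) * x)) = Real.exp (-(θ * x)) * Real.exp (-(l * x)) := by
      rw [← Real.exp_add]; ring_nf
    simp only [e1, e2, e3]
    field_simp
    ring
  linarith

theorem laplaceExponent_one_pos : 0 < laplaceExponent 1 := by
  unfold laplaceExponent
  have hpos : ∀ x ∈ Set.Ioi (0 : ℝ), 0 < (1 - Real.exp (-(1 * x))) * (Real.exp (-x) / x) := by
    intro x hx
    have hx : 0 < x := hx
    have h1 : Real.exp (-(1 * x)) < 1 := Real.exp_lt_one_iff.2 (by linarith)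
    exact mul_pos (by linarith) (by positivity)
  rw [setIntegral_pos_iff_support_of_nonneg_ae
    ((ae_restrict_mem measurableSet_Ioi).mono fun x hx => (hpos x hx).le)
    (integrableOn_laplaceExponent zero_le_one),
    Set.inter_eq_right.2 fun x hx => Function.mem_support.2 (hpos x hx).ne']
  simp

theorem laplaceExponent_zero : laplaceExponent 0 = 0 := by simp [laplaceExponent]

/-- Iterates the scaling relation to show that the exponent is unbounded without computing it as a
logarithm. -/
theorem laplaceExponent_two_pow_sub_one (n : ℕ) :
    laplaceExponent (2 ^ n - 1) = n * laplaceExponent 1 := by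
  induction n with
  | zero => simp [laplaceExponent_zero]
  | succ n ih =>
    have h1 : (1 : ℝ) ≤ 2 ^ n := one_le_pow₀ (by norm_num)
    have := laplaceExponent_add (l := 2 ^ n) (θ := 2 ^ n - 1) (by positivity) (by linarith)
    rw [show (2 : ℝ) ^ n - 1 + 2 ^ n = 2 ^ (n + 1) - 1 by ring, ih,
      show (2 : ℝ) ^ n / (1 + (2 ^ n - 1)) = 1 by field_simp; ring] at this
    rw [this]
    push_cast
    ring

end LaplaceExponent

/-! ### Normalized paths and strict monotonicity of the gamma process -/

section GammaProcess

variable {Ω : Type*} {m : MeasurableSpace Ω} {P : Measure Ω}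
  {γ : ℝ≥0 → Ω → ℝ}

theorem IsStandardGammaProcess.integral_exp_neg (hγ : IsStandardGammaProcess P γ) (t : ℝ≥0)
    {l : ℝ} (hl : 0 ≤ l) :
    ∫ ω, Real.exp (-(l * γ t ω)) ∂P = Real.exp (-(t * laplaceExponent l)) :=
  hγ.levyKhintchine t l hl

theorem IsStandardGammaProcess.integral_exp_neg_sub (hγ : IsStandardGammaProcess P γ)
    {s t : ℝ≥0} (hst : s ≤ t) {l : ℝ} (hl : 0 ≤ l) :
    ∫ ω, Real.exp (-(l * (γ t ω - γ s ω))) ∂P =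
      Real.exp (-(((t : ℝ) - s) * laplaceExponent l)) := by
  have h := hγ.stationaryIncrements s (t - s)
  rw [add_tsub_cancel_of_le hst] at h
  have h2 := (h.comp (u := fun x : ℝ => Real.exp (-(l * x))) (by fun_prop)).integral_eq
  simp only [Function.comp_def] at h2
  rw [h2, hγ.integral_exp_neg _ hl, NNReal.coe_sub hst]

theorem IsStandardGammaProcess.ae_nonneg (hγ : IsStandardGammaProcess P γ) :
    ∀ᵐ ω ∂P, ∀ t, 0 ≤ γ t ω := by
  filter_upwards [hγ.zero, hγ.monotone] with ω h0 hm t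
  rw [← h0]
  exact hm (zero_le (a := t))

theorem measurableSet_forall_nonneg {ι : Type*} [Fintype ι] :
    MeasurableSet {x : ι → ℝ | ∀ i, 0 ≤ x i} :=
  (isClosed_Ici (a := (0 : ι → ℝ))).measurableSet

variable [IsProbabilityMeasure P]

/-- Exponential tilting by the terminal value of a gamma process amounts to scaling the path,
at the level of finite dimensional Laplace transforms. -/
theorem IsStandardGammaProcess.integral_exp_tilt (hγ : IsStandardGammaProcess P γ)
    (I : Finset ℝ≥0) : ∀ (b : ℝ≥0) (θ : ℝ) (l : ℝ≥0 → ℝ), (∀ s ∈ I, s ≤ b) → 0 ≤ θ →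
      (∀ s, 0 ≤ l s) →
      ∫ ω, Real.exp (-(θ * γ b ω + ∑ s ∈ I, l s * γ s ω)) ∂P =
        Real.exp (-(b * laplaceExponent θ)) *
          ∫ ω, Real.exp (-∑ s ∈ I, l s / (1 + θ) * γ s ω) ∂P := by
  classical
  induction I using Finset.induction_on_max with
  | empty =>
    intro b θ l _ hθ _
    simp [hγ.integral_exp_neg b hθ]
  | insert a I hI ih =>
    intro b θ l hb hθ hl
    have hI' : ∀ s ∈ I, s ≤ a := fun s hs => (hI s hs).le
    have haI : a ∉ I := fun h => lt_irrefl _ (hI a h)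
    have hab : a ≤ b := hb a (Finset.mem_insert_self _ _)
    have hθ' : 0 < 1 + θ := by linarith
    -- Write `γ b` as `γ a` plus an independent increment. The weight `l a` of the largest time
    -- joins the tilt, which becomes `θ + l a` at time `a`.
    have hleft : ∫ ω, Real.exp (-(θ * γ b ω + ∑ s ∈ insert a I, l s * γ s ω)) ∂P =
        (∫ ω, Real.exp (-((θ + l a) * γ a ω + ∑ s ∈ I, l s * γ s ω)) ∂P) *
          ∫ ω, Real.exp (-(θ * (γ b ω - γ a ω))) ∂P := by
      have hind : IndepFun (fun ω => Real.exp (-((θ + l a) * γ a ω + ∑ s ∈ I, l s * γ s ω)))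
          (fun ω => Real.exp (-(θ * (γ b ω - γ a ω)))) P := by
        refine indep_of_indep_of_le_right (indep_of_indep_of_le_left
          (indep_past_increment hγ.measurable hγ.zero hγ.indepIncrements hab)
          (Measurable.comap_le ?_)) (Measurable.comap_le ?_)
        · refine Real.measurable_exp.comp (Measurable.neg (Measurable.add ?_ ?_))
          · exact (measurable_sigmaOn (Set.mem_Iic.2 le_rfl)).const_mul _
          · exact Finset.measurable_fun_sum _ fun s hs =>
              (measurable_sigmaOn (Set.mem_Iic.2 (hI' s hs))).const_mul _
        · have : Measurable fun x : ℝ => Real.exp (-(θ * x)) := by fun_prop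
          exact this.comp (comap_measurable (γ b - γ a))
      have hm := hγ.measurable
      rw [← hind.integral_fun_mul_eq_mul_integral
        (Measurable.aestronglyMeasurable (by fun_prop))
        (Measurable.aestronglyMeasurable (by fun_prop))]
      refine integral_congr_ae (ae_of_all _ fun ω => ?_)
      simp only [← Real.exp_add, Finset.sum_insert haI]
      ring_nf
    have hright := ih a (l a / (1 + θ)) (fun s => l s / (1 + θ)) hI' (by have := hl a; positivity)
      (fun s => by have := hl s; positivity)
    simp only [Finset.sum_insert haI] at hleft ⊢
    rw [hleft, ih a (θ + l a) l hI' (by have := hl a; positivity) hl,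
      hγ.integral_exp_neg_sub hab hθ, hright, laplaceExponent_add (hl a) hθ]
    -- Scalings compose: `(1 + θ)(1 + l a / (1 + θ)) = 1 + θ + l a`.
    have e : ∀ s, l s / (1 + θ) / (1 + l a / (1 + θ)) = l s / (1 + (θ + l a)) := by
      intro s
      have := hl a
      field_simp
      ring
    simp only [e]
    rw [mul_right_comm, ← mul_assoc, ← Real.exp_add, ← Real.exp_add]
    congr 2
    ring

/-- An event that is invariant under scaling of the path of a gamma process up to time `t` is
independent of its value at time `t`, in terms of Laplace transforms. -/
theorem IsStandardGammaProcess.setIntegral_exp_neg (hγ : IsStandardGammaProcess P γ)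
    (I : Finset ℝ≥0) {t : ℝ≥0} (ht : ∀ s ∈ I, s ≤ t) {A : Set (I → ℝ)} (hA : MeasurableSet A)
    (hscale : ∀ (c : ℝ) (x : I → ℝ), 0 < c → (c • x ∈ A ↔ x ∈ A)) {θ : ℝ} (hθ : 0 ≤ θ) :
    ∫ ω in {ω | (fun i : I => γ i ω) ∈ A}, Real.exp (-(θ * γ t ω)) ∂P =
      P.real {ω | (fun i : I => γ i ω) ∈ A} * ∫ ω, Real.exp (-(θ * γ t ω)) ∂P := by
  have hm := hγ.measurable
  have hθ' : 0 < 1 + θ := by linarith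
  have hV : Measurable fun ω (i : I) => γ i ω := measurable_pi_lambda _ fun i => hm i
  have hVθ : Measurable fun ω => (1 + θ)⁻¹ • (fun (i : I) => γ i ω) :=
    measurable_pi_lambda _ fun i => (hm i).const_mul _
  have hdm : Measurable fun ω => Real.toNNReal (Real.exp (-(θ * γ t ω))) := by fun_prop
  let Q : Measure Ω := P.withDensity fun ω => (Real.toNNReal (Real.exp (-(θ * γ t ω))) : ENNReal)
  let c : ℝ≥0 := Real.toNNReal (Real.exp (-(t * laplaceExponent θ)))
  have hint : Integrable (fun ω => Real.exp (-(θ * γ t ω))) P := by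
    refine Integrable.mono' (integrable_const (1 : ℝ))
      (Measurable.aestronglyMeasurable (by fun_prop)) ?_
    filter_upwards [hγ.ae_nonneg] with ω hω
    rw [Real.norm_eq_abs, Real.abs_exp, Real.exp_le_one_iff]
    have := mul_nonneg hθ (hω t)
    linarith
  have : IsFiniteMeasure Q := isFiniteMeasure_withDensity_ofReal hint.2
  have hQac : Q ≪ P := withDensity_absolutelyContinuous _ _
  -- The tilted law of the path is `c` times the law of the path divided by `1 + θ`. Evaluated at
  -- the scale-invariant set `A`, this gives the claim.
  have key : Q.map (fun ω (i : I) => γ i ω) =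
      c • P.map (fun ω => (1 + θ)⁻¹ • (fun (i : I) => γ i ω)) := by
    refine measure_ext_of_laplace ?_ ?_ fun l hl => ?_
    · rw [ae_map_iff hV.aemeasurable measurableSet_forall_nonneg]
      exact hQac.ae_le (hγ.ae_nonneg.mono fun ω hω i => hω i)
    · refine Measure.ae_smul_measure ?_ c
      rw [ae_map_iff hVθ.aemeasurable measurableSet_forall_nonneg]
      exact hγ.ae_nonneg.mono fun ω hω i => mul_nonneg (inv_nonneg.2 hθ'.le) (hω i)
    · rw [integral_smul_nnreal_measure, integral_map hV.aemeasurable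
        (Measurable.aestronglyMeasurable (by fun_prop)), integral_map hVθ.aemeasurable
        (Measurable.aestronglyMeasurable (by fun_prop)),
        integral_withDensity_eq_integral_smul hdm]
      classical
      have h := hγ.integral_exp_tilt I t θ (fun s => if h : s ∈ I then l ⟨s, h⟩ else 0) ht hθ
        (fun s => by by_cases h : s ∈ I <;> simp [h, hl])
      have e : ∀ (k : ℝ) ω, ∑ s ∈ I, (if h : s ∈ I then l ⟨s, h⟩ else 0) / k * γ s ω =
          ∑ i : I, l i / k * γ i ω := by
        intro k ω
        rw [← Finset.sum_coe_sort I]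
        exact Finset.sum_congr rfl fun i _ => by simp
      have e1 := e 1
      simp only [div_one] at e1
      simp only [e, e1] at h
      simp only [NNReal.smul_def, smul_eq_mul, c, Real.coe_toNNReal _ (Real.exp_pos _).le,
        ← Real.exp_add, Pi.smul_apply]
      convert h using 2
      · ext ω
        ring_nf
      · congr 1
        ext ω
        congr 2
        exact Finset.sum_congr rfl fun i _ => by ring
  have h1 := congrArg (fun μ => μ.real A) key
  have hAm : MeasurableSet {ω | (fun i : I => γ i ω) ∈ A} := hV hA
  simp only [measureReal_nnreal_smul_apply] at h1
  rw [map_measureReal_apply hV hA, map_measureReal_apply hVθ hA] at h1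
  have hset : (fun ω => (1 + θ)⁻¹ • (fun (i : I) => γ i ω)) ⁻¹' A =
      {ω | (fun i : I => γ i ω) ∈ A} := by
    ext ω
    exact hscale _ _ (inv_pos.2 hθ')
  have hQA : Q.real {ω | (fun i : I => γ i ω) ∈ A} =
      ∫ ω in {ω | (fun i : I => γ i ω) ∈ A}, Real.exp (-(θ * γ t ω)) ∂P := by
    rw [measureReal_def, withDensity_apply _ hAm]
    exact (integral_eq_lintegral_of_nonneg_ae (ae_of_all _ fun ω => (Real.exp_pos _).le)
      (Measurable.aestronglyMeasurable (by fun_prop))).symm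
  rw [hset] at h1
  rw [← hQA, hγ.integral_exp_neg t hθ, mul_comm]
  refine h1.trans ?_
  simp [c, (Real.exp_pos _).le]

/-- The path of a gamma process up to time `t`, normalized by its value at time `t`. -/
noncomputable def normalizedPath (γ : ℝ≥0 → Ω → ℝ) (t s : ℝ≥0) (ω : Ω) : ℝ := γ s ω / γ t ω

/-- The normalized path of a gamma process up to time `t` is independent of its value at `t`. -/
theorem IsStandardGammaProcess.indep_normalizedPath_eval (hγ : IsStandardGammaProcess P γ)
    (t : ℝ≥0) : Indep (sigmaOn (normalizedPath γ t) (Set.Iic t))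
      (MeasurableSpace.comap (γ t) inferInstance) P := by
  classical
  have hm := hγ.measurable
  refine IndepFun.process_indepFun (X := fun (s : Set.Iic t) => normalizedPath γ t s)
    (fun s => (hm s).div (hm t)) (hm t) fun I => ?_
  rw [indepFun_iff_measure_inter_preimage_eq_mul]
  intro S B hS hB
  -- Adjoining `t` makes the denominator `γ t` a coordinate, so that `A` below is a condition on
  -- ratios.
  let J : Finset ℝ≥0 := insert t (I.image Subtype.val)
  have htJ : t ∈ J := Finset.mem_insert_self _ _
  have hIJ : ∀ i : I, (i : ℝ≥0) ∈ J := fun i =>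
    Finset.mem_insert_of_mem (Finset.mem_image_of_mem _ i.2)
  let A : Set (J → ℝ) := {x | (fun i : I => x ⟨i, hIJ i⟩ / x ⟨t, htJ⟩) ∈ S}
  have hA : MeasurableSet A :=
    (measurable_pi_lambda (fun (x : J → ℝ) (i : I) => x ⟨i, hIJ i⟩ / x ⟨t, htJ⟩) fun i =>
      (measurable_pi_apply _).div (measurable_pi_apply _)) hS
  have hscale : ∀ (c : ℝ) (x : J → ℝ), 0 < c → (c • x ∈ A ↔ x ∈ A) := by
    intro c x hc
    simp only [A, Set.mem_ofPred_eq, Pi.smul_apply, smul_eq_mul, mul_div_mul_left _ _ hc.ne']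
  have hJt : ∀ s ∈ J, s ≤ t := by
    intro s hs
    obtain rfl | hs := Finset.mem_insert.1 hs
    · exact le_rfl
    · obtain ⟨i, -, rfl⟩ := Finset.mem_image.1 hs
      exact i.2
  let E : Set Ω := {ω | (fun i : J => γ i ω) ∈ A}
  -- Indexing by `Unit` brings the one-dimensional case under `measure_ext_of_laplace`.
  let V : Ω → Unit → ℝ := fun ω _ => γ t ω
  have hV : Measurable V := measurable_pi_lambda _ fun _ => hm t
  have hEm : MeasurableSet E := (measurable_pi_lambda (fun ω (i : J) => γ i ω) fun i => hm i) hA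
  have hVnonneg : ∀ᵐ ω ∂P, ∀ i, 0 ≤ V ω i := hγ.ae_nonneg.mono fun ω hω _ => hω t
  have key : (P.restrict E).map V = (P E).toNNReal • P.map V := by
    refine measure_ext_of_laplace ?_ ?_ fun l hl => ?_
    · rw [ae_map_iff hV.aemeasurable measurableSet_forall_nonneg]
      exact ae_restrict_of_ae hVnonneg
    · refine Measure.ae_smul_measure ?_ _
      rw [ae_map_iff hV.aemeasurable measurableSet_forall_nonneg]
      exact hVnonneg
    · rw [integral_smul_nnreal_measure, integral_map hV.aemeasurable
        (Measurable.aestronglyMeasurable (by fun_prop)), integral_map hV.aemeasurable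
        (Measurable.aestronglyMeasurable (by fun_prop))]
      simpa [V, NNReal.smul_def, E, measureReal_def, ENNReal.coe_toNNReal_eq_toReal] using hγ.setIntegral_exp_neg J hJt hA hscale (hl ())
  have hB' : MeasurableSet {x : Unit → ℝ | x () ∈ B} := measurable_pi_apply () hB
  have h := congrArg (fun μ => μ {x : Unit → ℝ | x () ∈ B}) key
  rw [Measure.map_apply hV hB', Measure.restrict_apply (hV hB')] at h
  simp only [Measure.smul_apply, Measure.map_apply hV hB', ENNReal.smul_def,
    ENNReal.coe_toNNReal (measure_ne_top P E), smul_eq_mul] at h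
  rw [Set.inter_comm] at h
  exact h

/-- The normalized path of a gamma process up to time `t` is independent of the process after
time `t`. -/
theorem IsStandardGammaProcess.indep_normalizedPath_future (hγ : IsStandardGammaProcess P γ)
    (t : ℝ≥0) : Indep (sigmaOn (normalizedPath γ t) (Set.Iic t)) (sigmaOn γ (Set.Ici t)) P := by
  have hm := hγ.measurable
  have hD : sigmaOn (normalizedPath γ t) (Set.Iic t) ≤ sigmaOn γ (Set.Iic t) :=
    sigmaOn_le fun s hs => (measurable_sigmaOn hs).div (measurable_sigmaOn (Set.mem_Iic.2 le_rfl))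
  have hpast : sigmaOn γ (Set.Iic t) ≤ m := sigmaOn_le fun s _ => hm s
  have ht : MeasurableSpace.comap (γ t) inferInstance ≤ sigmaOn γ (Set.Iic t) :=
    (measurable_sigmaOn (Set.mem_Iic.2 le_rfl)).comap_le
  have hfut : sigmaOn (fun u => γ u - γ t) (Set.Ici t) ≤ m :=
    sigmaOn_le fun s _ => (hm s).sub (hm t)
  refine indep_of_indep_of_le_right (indep_sup_of_indep_sup (hD.trans hpast) (ht.trans hpast) hfut
    (hγ.indep_normalizedPath_eval t) (indep_of_indep_of_le_left
      (indep_past_increments hm hγ.zero hγ.indepIncrements t) (sup_le hD ht)))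
    (sigmaOn_le fun u hu => ?_)
  have h1 : Measurable[MeasurableSpace.comap (γ t) inferInstance ⊔
      sigmaOn (fun u => γ u - γ t) (Set.Ici t)] (γ t) :=
    (comap_measurable _).mono le_sup_left le_rfl
  have h2 : Measurable[MeasurableSpace.comap (γ t) inferInstance ⊔
      sigmaOn (fun u => γ u - γ t) (Set.Ici t)] (γ u - γ t) :=
    (measurable_sigmaOn (X := fun u => γ u - γ t) hu).mono le_sup_right le_rfl
  simpa using h2.add h1

theorem IsStandardGammaProcess.indep_normalizedPath_future_sup (hγ : IsStandardGammaProcess P γ)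
    {τ : Ω → ℝ≥0} (hτ : Measurable τ) (hind : IndepFun τ (fun ω (t : ℝ≥0) => γ t ω) P)
    (t : ℝ≥0) : Indep (sigmaOn (normalizedPath γ t) (Set.Iic t))
      (sigmaOn γ (Set.Ici t) ⊔ MeasurableSpace.comap τ inferInstance) P := by
  have hm := hγ.measurable
  have hc : ∀ s, Measurable[MeasurableSpace.comap (fun ω (t : ℝ≥0) => γ t ω) MeasurableSpace.pi]
      (γ s) := fun s => 
    (@measurable_pi_iff _ _ _ (MeasurableSpace.comap (fun ω (t : ℝ≥0) => γ t ω)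
      MeasurableSpace.pi) _ _).1 (comap_measurable _) s
  refine indep_sup_of_indep_sup (sigmaOn_le fun s _ => (hm s).div (hm t))
    (sigmaOn_le fun s _ => hm s) hτ.comap_le (hγ.indep_normalizedPath_future t)
    (indep_of_indep_of_le_left hind.symm (sup_le ?_ ?_))
  · exact sigmaOn_le fun s _ => (hc s).div (hc t)
  · exact sigmaOn_le fun s _ => hc s

/-- The atom at `0` is bounded by every Laplace transform value; at `2^n - 1` this value is the
`n`-th power of a number below `1`. -/
theorem IsStandardGammaProcess.ae_ne_zero (hγ : IsStandardGammaProcess P γ) {t : ℝ≥0}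
    (ht : 0 < t) : ∀ᵐ ω ∂P, γ t ω ≠ 0 := by
  have hm := hγ.measurable
  have hset : MeasurableSet {ω | γ t ω = 0} := hm t (measurableSet_singleton 0)
  have hle : ∀ n : ℕ, P.real {ω | γ t ω = 0} ≤ Real.exp (-(t * laplaceExponent 1)) ^ n := by
    intro n
    have hl : (0 : ℝ) ≤ 2 ^ n - 1 := by
      have : (1 : ℝ) ≤ 2 ^ n := one_le_pow₀ (by norm_num)
      linarith
    have h := hγ.integral_exp_neg t hl
    have hint : Integrable (fun ω => Real.exp (-((2 ^ n - 1) * γ t ω))) P := by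
      refine .of_integral_ne_zero ?_
      rw [h]
      exact (Real.exp_pos _).ne'
    rw [laplaceExponent_two_pow_sub_one] at h
    rw [← Real.exp_nat_mul, show (n : ℝ) * -(t * laplaceExponent 1) =
      -(t * (n * laplaceExponent 1)) by ring, ← h]
    calc P.real {ω | γ t ω = 0} = ∫ ω in {ω | γ t ω = 0}, Real.exp (-((2 ^ n - 1) * γ t ω)) ∂P := by
          rw [setIntegral_congr_fun (g := fun _ => (1 : ℝ)) hset fun ω hω => by
            have hω : γ t ω = 0 := hω
            simp [hω]]
          simp
      _ ≤ _ := setIntegral_le_integral hint (ae_of_all _ fun ω => (Real.exp_pos _).le)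
  have hlim : Tendsto (fun n : ℕ => Real.exp (-(t * laplaceExponent 1)) ^ n) atTop (𝓝 0) := by
    refine tendsto_pow_atTop_nhds_zero_of_lt_one (Real.exp_pos _).le (Real.exp_lt_one_iff.2 ?_)
    have := mul_pos (NNReal.coe_pos.2 ht) laplaceExponent_one_pos
    linarith
  have h0 : P.real {ω | γ t ω = 0} = 0 :=
    le_antisymm (ge_of_tendsto' hlim hle) measureReal_nonneg
  rw [measureReal_eq_zero_iff] at h0
  simpa [ae_iff] using h0

/-- Increments over pairs from a countable dense set are a.s. all nonzero, and monotonicity carries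
this to every pair of times. -/
theorem IsStandardGammaProcess.ae_strictMono (hγ : IsStandardGammaProcess P γ) :
    ∀ᵐ ω ∂P, StrictMono fun t => γ t ω := by
  obtain ⟨S, hSc, hSd⟩ := TopologicalSpace.exists_countable_dense ℝ≥0
  have hne : ∀ s t : ℝ≥0, s < t → ∀ᵐ ω ∂P, γ t ω - γ s ω ≠ 0 := by
    intro s t hst
    have h := hγ.stationaryIncrements s (t - s)
    rw [add_tsub_cancel_of_le hst.le] at h
    exact h.symm.ae_snd (p := fun x : ℝ => x ≠ 0) (measurableSet_singleton 0).compl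
      (hγ.ae_ne_zero (tsub_pos_of_lt hst))
  have hall : ∀ᵐ ω ∂P, ∀ s ∈ S, ∀ t ∈ S, s < t → γ t ω - γ s ω ≠ 0 := by
    rw [ae_ball_iff hSc]
    intro s _
    rw [ae_ball_iff hSc]
    intro t _
    by_cases hst : s < t
    · exact (hne s t hst).mono fun ω h _ => h
    · exact ae_of_all _ fun ω h => absurd h hst
  filter_upwards [hall, hγ.monotone] with ω h hmono s t hst
  obtain ⟨q, hqS, hsq, hqt⟩ := hSd.exists_between hst
  obtain ⟨p, hpS, hsp, hpq⟩ := hSd.exists_between hsq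
  calc γ s ω ≤ γ p ω := hmono hsp.le
    _ < γ q ω := lt_of_le_of_ne (hmono hpq.le) fun e => h p hpS q hqS hpq (by simp [e])
    _ ≤ γ t ω := hmono hqt.le

end GammaProcess

/-! ### Right continuous processes at random times -/

section RandomTimes

variable {Ω : Type*}

theorem measurable_eval_countable {A : MeasurableSpace Ω} {f : ℕ → Ω → ℝ}
    (hf : ∀ k, Measurable (f k)) {N : Ω → ℕ} (hN : Measurable N) :
    Measurable fun ω => f (N ω) ω := by
  have : Measurable fun p : ℕ × Ω => f p.1 p.2 := measurable_from_prod_countable_right hf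
  exact this.comp (hN.prodMk measurable_id)

/-- A right continuous process evaluated at a random time after `t` is measurable, up to null
sets, with respect to the future of the process after `t` and the random time. -/
theorem eventuallyMeasurable_eval_randomTime {A : MeasurableSpace Ω} {l : Filter Ω}
    [CountableInterFilter l] {X : ℝ≥0 → Ω → ℝ} {t : ℝ≥0} (hX : ∀ s, t ≤ s → Measurable (X s))
    (hcont : ∀ᶠ ω in l, ∀ s, ContinuousWithinAt (fun s => X s ω) (Set.Ici s) s)
    {σ : Ω → ℝ≥0} (hσ : Measurable σ) (htσ : ∀ ω, t ≤ σ ω) :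
    EventuallyMeasurable A l fun ω => X (σ ω) ω := by
  -- The time `u n (N n ω)` is the first point of the grid of mesh `1 / (n + 1)` strictly above `σ
  -- ω`, so right continuity applies in the limit.
  let u : ℕ → ℕ → ℝ≥0 := fun n k => ((k : ℝ≥0) + 1) / ((n : ℝ≥0) + 1)
  let N : ℕ → Ω → ℕ := fun n ω => ⌊σ ω * ((n : ℝ≥0) + 1)⌋₊
  have hN : ∀ n, Measurable (N n) := fun n => Nat.measurable_floor.comp (hσ.mul_const _)
  have hmeas : ∀ n, Measurable fun ω => X (max t (u n (N n ω))) ω := fun n =>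
    measurable_eval_countable (f := fun k => X (max t (u n k)))
      (fun k => hX _ (le_max_left _ _)) (hN n)
  refine (Measurable.limsup hmeas).eventuallyMeasurable_of_eventuallyEq ?_
  filter_upwards [hcont] with ω hω
  have hpos : ∀ n : ℕ, (0 : ℝ≥0) < (n : ℝ≥0) + 1 := fun n => by positivity
  have hge : ∀ n, σ ω ≤ u n (N n ω) := fun n => by
    rw [le_div_iff₀ (hpos n)]
    exact (Nat.lt_floor_add_one _).le
  have hle : ∀ n, u n (N n ω) ≤ σ ω + 1 / ((n : ℝ≥0) + 1) := fun n => by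
    rw [div_le_iff₀ (hpos n), add_mul, one_div, inv_mul_cancel₀ (hpos n).ne']
    gcongr
    exact Nat.floor_le (zero_le (a := σ ω * ((n : ℝ≥0) + 1)))
  have hlim0 : Tendsto (fun n : ℕ => σ ω + 1 / ((n : ℝ≥0) + 1)) atTop (𝓝 (σ ω)) := by
    simpa using tendsto_const_nhds.add (tendsto_one_div_add_atTop_nhds_zero_nat (𝕜 := ℝ≥0))
  have hlim : Tendsto (fun n => u n (N n ω)) atTop (𝓝[Set.Ici (σ ω)] (σ ω)) :=
    tendsto_nhdsWithin_iff.2 ⟨tendsto_of_tendsto_of_tendsto_of_le_of_le tendsto_const_nhds hlim0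
      hge hle, Eventually.of_forall hge⟩
  have := (hω (σ ω)).tendsto.comp hlim
  have hmax : ∀ n, max t (u n (N n ω)) = u n (N n ω) := fun n =>
    max_eq_right ((htσ ω).trans (hge n))
  simp only [hmax]
  exact this.limsup_eq.symm

end RandomTimes

/-! ### Pathwise identities and measurability of the bridge -/

section RandomBridge

variable {Ω : Type*} {m : MeasurableSpace Ω} {P : Measure Ω} [IsProbabilityMeasure P]
  {γ : ℝ≥0 → Ω → ℝ} {τ : Ω → ℝ≥0}

theorem IsStandardGammaProcess.ae_eval_pos (hγ : IsStandardGammaProcess P γ) :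
    ∀ᵐ ω ∂P, ∀ t, 0 < t → 0 < γ t ω := by
  filter_upwards [hγ.zero, hγ.ae_strictMono] with ω h0 hm t ht
  rw [← h0]
  exact hm ht

/-- After its random length has elapsed, the bridge stays at `1`. -/
theorem ae_randomBridge_eq_one (hγ : IsStandardGammaProcess P γ) (hτpos : ∀ ω, 0 < τ ω)
    (t : ℝ≥0) : ∀ᵐ ω ∂P, τ ω ≤ t → randomBridge γ τ t ω = 1 := by
  filter_upwards [hγ.ae_eval_pos] with ω h ht
  rw [randomBridge, bridge, min_eq_right ht, div_self (h _ (hτpos ω)).ne']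

/-- Before its random length has elapsed, the bridge is not at `1`. -/
theorem ae_randomBridge_ne_one (hγ : IsStandardGammaProcess P γ) (hτpos : ∀ ω, 0 < τ ω)
    (t : ℝ≥0) : ∀ᵐ ω ∂P, t < τ ω → randomBridge γ τ t ω ≠ 1 := by
  filter_upwards [hγ.ae_eval_pos, hγ.ae_strictMono] with ω h hm ht
  rw [randomBridge, bridge, min_eq_left ht.le, ne_eq, div_eq_one_iff_eq (h _ (hτpos ω)).ne']
  exact (hm ht).ne

/-- While the bridge is not at `1`, its past is its present value times the normalized path. -/
theorem ae_randomBridge_eq_mul (hγ : IsStandardGammaProcess P γ) (hτpos : ∀ ω, 0 < τ ω)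
    {s t : ℝ≥0} (hst : s ≤ t) : ∀ᵐ ω ∂P, randomBridge γ τ t ω ≠ 1 →
      randomBridge γ τ s ω = normalizedPath γ t s ω * randomBridge γ τ t ω := by
  filter_upwards [ae_randomBridge_eq_one hγ hτpos t, hγ.ae_eval_pos, hγ.zero]
    with ω h1 hpos h0 hne
  have ht : t < τ ω := not_le.1 fun h => hne (h1 h)
  simp only [randomBridge, bridge, normalizedPath, min_eq_left ht.le,
    min_eq_left (hst.trans ht.le)]
  -- At `t = 0` the normalized path is `0 / 0 = 0`, and both sides vanish.
  obtain rfl | htpos := eq_zero_or_pos t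
  · obtain rfl : s = 0 := le_antisymm hst (zero_le (a := s))
    simp [h0]
  · rw [div_mul_div_cancel₀ (hpos t htpos).ne']

/-- The bridge after time `t` is a functional of the gamma process after time `t` and the random
length, up to null sets. -/
theorem measurable_randomBridge_future (hγ : IsStandardGammaProcess P γ) (hτpos : ∀ ω, 0 < τ ω)
    {s t : ℝ≥0} (hts : t ≤ s) :
    Measurable[eventuallyMeasurableSpace
      (sigmaOn γ (Set.Ici t) ⊔ MeasurableSpace.comap τ inferInstance) (ae P)]
      (randomBridge γ τ s) := by
  have hτA : Measurable[sigmaOn γ (Set.Ici t) ⊔ MeasurableSpace.comap τ inferInstance] τ :=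
    (comap_measurable τ).mono le_sup_right le_rfl
  have hX : ∀ u, t ≤ u →
      Measurable[sigmaOn γ (Set.Ici t) ⊔ MeasurableSpace.comap τ inferInstance] (γ u) :=
    fun u hu => (measurable_sigmaOn (Set.mem_Ici.2 hu)).mono le_sup_left le_rfl
  have hcont : ∀ᵐ ω ∂P, ∀ s, ContinuousWithinAt (fun s => γ s ω) (Set.Ici s) s :=
    hγ.cadlag.mono fun ω h s => (h s).1
  -- The maximum with `t` keeps the random time in `[t, ∞)`; it changes nothing on `{t < τ}`, the
  -- only event where the value is used.
  have h1 : EventuallyMeasurable (sigmaOn γ (Set.Ici t) ⊔ MeasurableSpace.comap τ inferInstance)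
      (ae P) fun ω => γ (max t (min s (τ ω))) ω :=
    eventuallyMeasurable_eval_randomTime hX hcont (measurable_const.max (measurable_const.min hτA))
      fun ω => le_max_left _ _
  have h2 : EventuallyMeasurable (sigmaOn γ (Set.Ici t) ⊔ MeasurableSpace.comap τ inferInstance)
      (ae P) fun ω => γ (max t (τ ω)) ω :=
    eventuallyMeasurable_eval_randomTime hX hcont (measurable_const.max hτA)
      fun ω => le_max_left _ _
  have hset : MeasurableSet[eventuallyMeasurableSpace
      (sigmaOn γ (Set.Ici t) ⊔ MeasurableSpace.comap τ inferInstance) (ae P)] {ω | t < τ ω} :=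
    le_eventuallyMeasurableSpace _ (hτA measurableSet_Ioi)
  refine measurable_eventually_congr
    (f := fun ω => if t < τ ω then γ (max t (min s (τ ω))) ω / γ (max t (τ ω)) ω else 1)
    (Measurable.ite hset (Measurable.div h1 h2) measurable_const) ?_
  filter_upwards [ae_randomBridge_eq_one hγ hτpos s] with ω hω
  by_cases ht : t < τ ω
  · rw [if_pos ht, max_eq_right (le_min hts ht.le), max_eq_right ht.le]
    rfl
  · rw [if_neg ht, hω ((not_lt.1 ht).trans hts)]

theorem measurable_randomBridge [P.IsComplete] (hγ : IsStandardGammaProcess P γ)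
    (hτ : Measurable τ) (hτpos : ∀ ω, 0 < τ ω) (t : ℝ≥0) : Measurable (randomBridge γ τ t) :=
  (measurable_randomBridge_future hγ hτpos (zero_le (a := t))).mono
    (eventuallyMeasurableSpace_le_of_isComplete
      (sup_le (sigmaOn_le fun s _ => hγ.measurable s) hτ.comap_le)) le_rfl

end RandomBridge

/-! ### Gluing along `{ζ_t ≠ 1}` and the Markov property -/

section Markov

variable {Ω : Type*} {m : MeasurableSpace Ω} {P : Measure Ω}

/-- The σ-algebra of the sets whose trace on `A` belongs to `H`. -/
@[reducible] def traceSpace (H : MeasurableSpace Ω) {A : Set Ω} (hA : MeasurableSet[H] A) :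
    MeasurableSpace Ω where
  MeasurableSet' F := MeasurableSet[H] (F ∩ A)
  measurableSet_empty := by simp
  measurableSet_compl F hF := by
    have : Fᶜ ∩ A = A \ (F ∩ A) := by ext; simp; tauto
    rw [this]
    exact hA.diff hF
  measurableSet_iUnion F hF := by
    rw [Set.iUnion_inter]
    exact MeasurableSet.iUnion hF

/-- If conditioning on `H` is the same as conditioning on `Z`, then so is conditioning on a
σ-algebra that agrees with `H` on an event `A` outside of which `X` is constant. -/
theorem condExp_eq_of_trace [IsProbabilityMeasure P] {Z H F : MeasurableSpace Ω} (hH : H ≤ m)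
    (hF : F ≤ m) (hZF : Z ≤ F) {A : Set Ω} (hA : MeasurableSet[Z] A)
    (hloc : ∀ s, MeasurableSet[F] s → MeasurableSet[eventuallyMeasurableSpace H (ae P)] (s ∩ A))
    {X : Ω → ℝ} (hX : Integrable X P) (hXH : P[X | H] =ᵐ[P] P[X | Z]) {c : ℝ}
    (hXA : ∀ᵐ ω ∂P, ω ∉ A → X ω = c) : P[X | F] =ᵐ[P] P[X | Z] := by
  have hZ : Z ≤ m := hZF.trans hF
  have hAm : MeasurableSet[m] A := hZ _ hA
  -- As `A` belongs to `Z`, the indicator of its complement comes out of the conditional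
  -- expectation, where `X` is the constant `c`.
  have hout : ∀ᵐ ω ∂P, ω ∉ A → (P[X | Z]) ω = X ω := by
    have h1 := condExp_indicator hX hA.compl
    have h2 : P[Aᶜ.indicator X | Z] =ᵐ[P] P[Aᶜ.indicator fun _ => c | Z] := by
      refine condExp_congr_ae (hXA.mono fun ω hω => ?_)
      by_cases h : ω ∈ A
      · simp [h]
      · simp [h, hω h]
    have h3 : P[Aᶜ.indicator fun _ => c | Z] = Aᶜ.indicator fun _ => c :=
      condExp_of_stronglyMeasurable hZ (stronglyMeasurable_const.indicator hA.compl)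
        ((integrable_const c).indicator hAm.compl)
    rw [h3] at h2
    filter_upwards [h1, h2, hXA] with ω e1 e2 e3 h
    rw [e2] at e1
    simp only [Set.indicator_of_mem (Set.mem_compl h)] at e1
    rw [← e1, e3 h]
  refine (ae_eq_condExp_of_forall_setIntegral_eq hF hX
    (fun s _ _ => integrable_condExp.integrableOn) (fun s hs _ => ?_)
    (StronglyMeasurable.mono (stronglyMeasurable_condExp (m := Z)) hZF).aestronglyMeasurable).symm
  have hsm : MeasurableSet[m] s := hF _ hs
  rw [← integral_inter_add_sdiff hAm integrable_condExp.integrableOn,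
    ← integral_inter_add_sdiff hAm hX.integrableOn]
  congr 1
  · obtain ⟨u, hu, hsu⟩ := hloc s hs
    rw [setIntegral_congr_set hsu, setIntegral_congr_set hsu, ← setIntegral_condExp hH hX hu]
    exact setIntegral_congr_ae (hH _ hu) (hXH.mono fun ω h _ => h.symm)
  · exact setIntegral_congr_ae (hsm.diff hAm) (hout.mono fun ω h hω => h hω.2)

theorem measurable_naturalFiltration {Y : ℝ≥0 → Ω → ℝ} {s t : ℝ≥0} (hst : s ≤ t) :
    Measurable[naturalFiltration Y t] (Y s) :=
  (comap_measurable (Y s)).mono (le_iSup₂_of_le s hst le_rfl) le_rfl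

theorem naturalFiltration_le {Y : ℝ≥0 → Ω → ℝ} {t : ℝ≥0} {A : MeasurableSpace Ω}
    (h : ∀ s ≤ t, Measurable[A] (Y s)) : naturalFiltration Y t ≤ A :=
  iSup₂_le fun s hs => (h s hs).comap_le

theorem naturalFiltration_mono (Y : ℝ≥0 → Ω → ℝ) : Monotone (naturalFiltration Y) :=
  fun _ _ hst => naturalFiltration_le fun _ hs => measurable_naturalFiltration (hs.trans hst)

variable {γ : ℝ≥0 → Ω → ℝ} {τ : Ω → ℝ≥0}

theorem completedNaturalFiltration_le [P.IsComplete] {Y : ℝ≥0 → Ω → ℝ} (hY : ∀ t, Measurable (Y t)) (t : ℝ≥0) :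
    completedNaturalFiltration P Y t ≤ m :=
  sup_le (naturalFiltration_le fun s _ => hY s)
    (MeasurableSpace.generateFrom_le fun _ hN => Measure.IsComplete.out' _ hN)

variable [IsProbabilityMeasure P] [P.IsComplete]

/-- The Markov property of the bridge with respect to any σ-algebra between the one generated by
its present value and the completion of the one generated by its past. -/
theorem condExp_randomBridge_eq (hγ : IsStandardGammaProcess P γ) (hτ : Measurable τ)
    (hτpos : ∀ ω, 0 < τ ω) (hind : IndepFun τ (fun ω (t : ℝ≥0) => γ t ω) P) (t h : ℝ≥0)
    {f : ℝ → ℝ} (hf : Measurable f) {C : ℝ} (hC : ∀ x, |f x| ≤ C) {F : MeasurableSpace Ω}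
    (hZF : MeasurableSpace.comap (randomBridge γ τ t) inferInstance ≤ F)
    (hF : F ≤ completedNaturalFiltration P (randomBridge γ τ) t) :
    P[fun ω => f (randomBridge γ τ (t + h) ω) | F] =ᵐ[P]
      P[fun ω => f (randomBridge γ τ (t + h) ω) |
        MeasurableSpace.comap (randomBridge γ τ t) inferInstance] := by
  have hζ := measurable_randomBridge hγ hτ hτpos
  let Z : MeasurableSpace Ω := MeasurableSpace.comap (randomBridge γ τ t) inferInstance
  let D : MeasurableSpace Ω := sigmaOn (normalizedPath γ t) (Set.Iic t)
  let G : MeasurableSpace Ω := eventuallyMeasurableSpace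
    (sigmaOn γ (Set.Ici t) ⊔ MeasurableSpace.comap τ inferInstance) (ae P)
  have hD : D ≤ m := sigmaOn_le fun s _ => (hγ.measurable s).div (hγ.measurable t)
  have hG : G ≤ m := eventuallyMeasurableSpace_le_of_isComplete
    (sup_le (sigmaOn_le fun s _ => hγ.measurable s) hτ.comap_le)
  have hZG : Z ≤ G := (measurable_randomBridge_future hγ hτpos le_rfl).comap_le
  have hDG : Indep D G P :=
    indep_eventuallyMeasurableSpace (hγ.indep_normalizedPath_future_sup hτ hind t)
  have hXG : StronglyMeasurable[G] fun ω => f (randomBridge γ τ (t + h) ω) :=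
    (hf.comp (measurable_randomBridge_future hγ hτpos
      (le_add_of_nonneg_right (zero_le (a := h))))).stronglyMeasurable
  have hXi : Integrable (fun ω => f (randomBridge γ τ (t + h) ω)) P :=
    Integrable.mono' (integrable_const C) (hf.comp (hζ _)).aestronglyMeasurable
      (ae_of_all _ fun ω => hC _)
  have hA : MeasurableSet[Z] {ω | randomBridge γ τ t ω ≠ 1} :=
    ⟨{1}ᶜ, (measurableSet_singleton 1).compl, rfl⟩
  have hZH : Z ≤ eventuallyMeasurableSpace (D ⊔ Z) (ae P) :=
    (le_sup_right (a := D)).trans le_eventuallyMeasurableSpace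
  -- Sets with a good trace form a σ-algebra, so only generators need checking: on `{ζ_t ≠ 1}` the
  -- past is a product of a `D`-measurable factor and `ζ_t`, and null sets have null trace.
  have hlocal : completedNaturalFiltration P (randomBridge γ τ) t ≤
      traceSpace (eventuallyMeasurableSpace (D ⊔ Z) (ae P)) (hZH _ hA) := by
    refine sup_le (iSup₂_le fun s hs => ?_) (MeasurableSpace.generateFrom_le fun N hN => ?_)
    · rintro _ ⟨B, hB, rfl⟩
      have hmul : Measurable[D ⊔ Z]
          fun ω => normalizedPath γ t s ω * randomBridge γ τ t ω :=
        ((measurable_sigmaOn (Set.mem_Iic.2 hs)).mono le_sup_left le_rfl).mul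
          ((comap_measurable (randomBridge γ τ t)).mono le_sup_right le_rfl)
      refine ⟨_, @MeasurableSet.inter _ (D ⊔ Z) _ _ (hmul hB) (le_sup_right (a := D) _ hA), ?_⟩
      refine eventuallyEq_set.2 ((ae_randomBridge_eq_mul hγ hτpos hs).mono fun ω hω => ?_)
      simp only [Set.mem_inter_iff, Set.mem_preimage]
      exact and_congr_left fun hne => by rw [hω hne]
    · exact ⟨∅, @MeasurableSet.empty _ (D ⊔ Z),
        ae_eq_empty.2 (measure_mono_null Set.inter_subset_left hN)⟩
  refine condExp_eq_of_trace (sup_le hD (hZG.trans hG))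
    (hF.trans (completedNaturalFiltration_le hζ t)) hZF hA (fun s hs => hlocal _ (hF _ hs)) hXi
    (condExp_sup_eq_of_indep hD hG hZG hDG hXG hXi) (c := f 1) ?_
  filter_upwards [ae_randomBridge_ne_one hγ hτpos t, ae_randomBridge_eq_one hγ hτpos (t + h)]
    with ω h1 h2 hω
  have ht : τ ω ≤ t := not_lt.1 fun h => hω (h1 h)
  rw [h2 (ht.trans (le_add_of_nonneg_right (zero_le (a := h))))]

end Markov

end GammaBridge

theorem mainTheorem3 {Ω : Type*} {m : MeasurableSpace Ω} (P : Measure Ω)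
    [IsProbabilityMeasure P] [P.IsComplete]
    (γ : ℝ≥0 → Ω → ℝ) (hγ : GammaBridge.IsStandardGammaProcess P γ)
    (τ : Ω → ℝ≥0) (hτ : Measurable τ) (hτpos : ∀ ω, 0 < τ ω)
    (hind : IndepFun τ (fun ω (t : ℝ≥0) => γ t ω) P) :
    GammaBridge.IsMarkov P (GammaBridge.randomBridge γ τ)
        (GammaBridge.naturalFiltration (GammaBridge.randomBridge γ τ)) ∧
      GammaBridge.IsMarkov P (GammaBridge.randomBridge γ τ)
        (GammaBridge.completedNaturalFiltration P (GammaBridge.randomBridge γ τ)) := by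
  have hζ := GammaBridge.measurable_randomBridge hγ hτ hτpos
  have hmono := GammaBridge.naturalFiltration_mono (GammaBridge.randomBridge γ τ)
  have hadapt : ∀ t, Measurable[GammaBridge.naturalFiltration (GammaBridge.randomBridge γ τ) t]
      (GammaBridge.randomBridge γ τ t) := fun t => GammaBridge.measurable_naturalFiltration le_rfl
  refine ⟨⟨hmono, fun t => GammaBridge.naturalFiltration_le fun s _ => hζ s, hadapt, ?_⟩,
    ⟨fun s t hst => sup_le_sup_right (hmono hst) _,
      GammaBridge.completedNaturalFiltration_le hζ,
      fun t => (hadapt t).mono le_sup_left le_rfl, ?_⟩⟩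
  · rintro t h f hf ⟨C, hC⟩
    exact GammaBridge.condExp_randomBridge_eq hγ hτ hτpos hind t h hf hC (hadapt t).comap_le
      le_sup_left
  · rintro t h f hf ⟨C, hC⟩
    exact GammaBridge.condExp_randomBridge_eq hγ hτ hτpos hind t h hf hC
      ((hadapt t).comap_le.trans le_sup_left) le_rfl
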